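/- Let $A$ be a finite alphabet and let $P$ and $Q$ be shift-invariant Borel probability measures on the space $A^{\mathbb{N}}$ of one-sided sequences $x=(x_k)_{k\ge 1}$; write $x_i^j=(x_i,\dots,x_j)$. Suppose that $Q$ satisfies the following upper-decoupling condition: there exist a sequence $(c_n)_{n\ge1}$ of real numbers and a sequence $(\tau_n)_{n\ge1}$ of nonnegative integers, with $c_n=o(n)$ and $\tau_n=o(n)$ as $n\to\infty$, such that $$Q\{x : x_1^n=a,\ x_{n+\tau_n+1}^{n+\tau_n+m}=b\}\le e^{c_n}\,Q\{x : x_1^n=a\}\,Q\{x : x_{n+\tau_n+1}^{n+\tau_n+m}=b\}$$ for all $n,m\ge1$, $a\in A^n$ and $b\in A^m$. Then the limit $$h_{P,Q}(x)=\lim_{n\to\infty}\frac1n\log Q\{y : y_1^n=x_1^n\}$$ exists in $[-\infty,0]$ for $P$-almost every $x$ (with $\log 0=-\infty$). Moreover, the specific relative entropy of $P$ with respect to $Q$, $$\lim_{n\to\infty}\frac1n\sum_{a\in A^n}P_n(a)\log\frac{P_n(a)}{Q_n(a)},$$ exists in $[0,+\infty]$, where $P_n$ and $Q_n$ are the laws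 of $x_1^n$ under $P$ and $Q$, $0\log\frac{0}{q}=0$ for every $q\ge 0$, and $p\log\frac p0=+\infty$ for $p>0$. -/

import Mathlib

open MeasureTheory Filter Topology Asymptotics
open scoped ENNReal

namespace OneSidedShift

variable {A : Type*}

/-- The left shift on one-sided sequences. The letters of a sequence are numbered from `0`, so that
the letter `x_k` of a sequence `(x_k)_{k ≥ 1}` is `x (k - 1)` here. -/
def shift (x : ℕ → A) : ℕ → A := fun k => x (k + 1)

/-- The word of length `m` that follows the first `k` letters of `x`, that is, `x_{k+1}^{k+m}` in
the numbering that starts from `1`. -/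
def window (k m : ℕ) (x : ℕ → A) : Fin m → A := fun j => x (k + j)

variable [MeasurableSpace A]

/-- Shift invariance of a measure on one-sided sequences. -/
def ShiftInvariant (P : Measure (ℕ → A)) : Prop :=
  MeasurePreserving (shift (A := A)) P P

/-- The `n`-th marginal: the law of the first `n` letters. -/
noncomputable def marginal (P : Measure (ℕ → A)) (n : ℕ) : Measure (Fin n → A) :=
  P.map (window 0 n)

/-- The upper-decoupling condition with `o(n)` error terms `c n` and gaps `τ n`. -/
def UpperDecoupled (Q : Measure (ℕ → A)) : Prop :=
  ∃ (c : ℕ → ℝ) (τ : ℕ → ℕ),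
    (c =o[atTop] fun n : ℕ => (n : ℝ)) ∧
    ((fun n : ℕ => (τ n : ℝ)) =o[atTop] fun n : ℕ => (n : ℝ)) ∧
    ∀ n m : ℕ, 1 ≤ n → 1 ≤ m → ∀ (a : Fin n → A) (b : Fin m → A),
      Q {x | window 0 n x = a ∧ window (n + τ n) m x = b} ≤
        ENNReal.ofReal (Real.exp (c n)) * Q {x | window 0 n x = a} *
          Q {x | window (n + τ n) m x = b}

/-- `s` is the specific relative entropy of `P` with respect to `Q`: the relative entropies
(Kullback-Leibler divergences) of the `n`-th marginals, divided by `n`, converge to `s`. -/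
def HasSpecificRelativeEntropy (P Q : Measure (ℕ → A)) (s : ℝ≥0∞) : Prop :=
  Tendsto (fun n : ℕ => InformationTheory.klDiv (marginal P n) (marginal Q n) / (n : ℝ≥0∞))
    atTop (𝓝 s)

end OneSidedShift

/-!
Write `q n x` for the `Q`-probability that a sequence starts with the first `n` letters of `x`
(`wordProb`). Upper decoupling and invariance of `Q` say that
`q (n + τ n + m) x ≤ exp (c n) * q n x * q m (T^(n + τ n) x)`, where `T` is the shift, so `log q` is
subadditive up to sublinear errors and gaps. Two facts compensate for the gaps: `q ≤ 1`, and
`q (n + 1) x ≤ q n (T x)`, so that letters may be dropped from a word at no cost.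

*Pointwise limit.* It has to be shown that a lower rate `≤ r` forces an upper rate `≤ s` almost
everywhere, for `r < s < 0` (`GappedSubmultiplicative.ae_eventually_le_exp`). The set of points with
lower rate `≤ r` contains its preimage under `T`, so by invariance of `P` almost every orbit that
starts in it stays in it. From each of its points some block of length at most `L` has rate
about `r`, except on a set `B L` whose measure tends to `0` as `L → ∞`. Covering `[0, m)` greedily by
such blocks together with their gaps, and skipping one letter at each visit to `B L`, bounds `q m x`
by `exp (s * m)`, provided that the visits to `B L` are rare
(`GappedSubmultiplicative.le_exp_of_cover`). They are for some `L`, almost everywhere, by the maximal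
inequality for visit frequencies (`ae_exists_birkhoffSum_indicator_le`), which comes from the same
kind of greedy covering and replaces the pointwise ergodic theorem. The set of good points is
described by inequalities `q n x ≤ exp (r * n)`, so that `log 0 = -∞` enters only at the end.

*Relative entropy.* If some marginal of `P` is not absolutely continuous with respect to that of
`Q`, the same holds for all longer words and the limit is `∞`. Otherwise the divergence of the
`n`-th marginals is `∫ log p n ∂P - ∫ log q n ∂P`, with `p` the word probabilities of `P`. The first
term divided by `n` has a finite limit by subadditivity of the block entropies
(`subadditive_neg_meanLogProb`); the second one has a limit in `[-∞, 0]` by the gapped Fekete lemma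
`exists_tendsto_div_of_gapped_subadditive`, which is the ergodic theorem above on a one-point space.
-/

section Ergodic

variable {X : Type*} {T : X → X}

/-! ### A maximal inequality for visits to a set -/

lemma birkhoffSum_indicator_nonneg (B : Set X) (n : ℕ) (x : X) :
    0 ≤ birkhoffSum T (B.indicator (1 : X → ℝ)) n x :=
  Finset.sum_nonneg fun _ _ => Set.indicator_nonneg (fun _ _ => zero_le_one) _

lemma birkhoffSum_indicator_le (B : Set X) (n : ℕ) (x : X) :
    birkhoffSum T (B.indicator (1 : X → ℝ)) n x ≤ n := by
  calc birkhoffSum T (B.indicator (1 : X → ℝ)) n x ≤ ∑ _i ∈ Finset.range n, (1 : ℝ) :=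
        Finset.sum_le_sum fun _ _ => Set.indicator_le_self' (fun _ _ => zero_le_one) _
    _ = n := by simp

lemma birkhoffSum_indicator_mono (B : Set X) {m n : ℕ} (hmn : m ≤ n) (x : X) :
    birkhoffSum T (B.indicator (1 : X → ℝ)) m x ≤ birkhoffSum T (B.indicator 1) n x := by
  obtain ⟨k, rfl⟩ := Nat.exists_eq_add_of_le hmn
  rw [birkhoffSum_add]
  linarith [birkhoffSum_indicator_nonneg (T := T) B k (T^[m] x)]

/-- The combinatorial core of the maximal inequality: whenever the orbit is at a point from which
some block of length at most `N` has `B`-frequency above `δ`, that block is skipped as a whole, so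
that the skipped blocks are disjoint and account for all such times below `K`. -/
lemma mul_birkhoffSum_indicator_le (B : Set X) {δ : ℝ} (hδ : 0 ≤ δ) (N K : ℕ) (x : X) :
    δ * birkhoffSum T ({y | ∃ m, 1 ≤ m ∧ m ≤ N ∧
        δ * m < birkhoffSum T (B.indicator (1 : X → ℝ)) m y}.indicator 1) K x ≤
      birkhoffSum T (B.indicator 1) (K + N) x := by
  set E : Set X := {y | ∃ m, 1 ≤ m ∧ m ≤ N ∧
        δ * m < birkhoffSum T (B.indicator (1 : X → ℝ)) m y}
  induction K using Nat.strong_induction_on generalizing x with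
  | _ K ih =>
  rcases Nat.eq_zero_or_pos K with rfl | hK
  · simpa using birkhoffSum_indicator_nonneg (T := T) B N x
  by_cases hx : x ∈ E
  · obtain ⟨m, hm1, hmN, hm⟩ := hx
    rcases le_or_gt K m with hKm | hKm
    · calc δ * birkhoffSum T (E.indicator 1) K x ≤ δ * K :=
            mul_le_mul_of_nonneg_left (birkhoffSum_indicator_le E K x) hδ
        _ ≤ δ * m := by gcongr
        _ ≤ _ := hm.le
        _ ≤ _ := birkhoffSum_indicator_mono B (by omega) x
    · obtain ⟨k, rfl⟩ := Nat.exists_eq_add_of_le hKm.le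
      have h1 := ih k (by omega) (T^[m] x)
      have h2 := mul_le_mul_of_nonneg_left (birkhoffSum_indicator_le (T := T) E m x) hδ
      rw [add_assoc, birkhoffSum_add, birkhoffSum_add, mul_add]
      linarith
  · obtain ⟨k, rfl⟩ : ∃ k, K = k + 1 := ⟨K - 1, by omega⟩
    have h1 := ih k (by omega) (T x)
    rw [show k + 1 + N = (k + N) + 1 by ring, birkhoffSum_succ', birkhoffSum_succ',
      Set.indicator_of_notMem hx, zero_add]
    have : 0 ≤ B.indicator (1 : X → ℝ) x := Set.indicator_nonneg (fun _ _ => zero_le_one) _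
    linarith

section Measure

variable [MeasurableSpace X] {P : Measure X}

lemma measurable_birkhoffSum (hT : Measurable T) {g : X → ℝ} (hg : Measurable g) (n : ℕ) :
    Measurable (birkhoffSum T g n) :=
  Finset.measurable_fun_sum _ fun i _ => hg.comp (hT.iterate i)

lemma integrable_birkhoffSum_indicator [IsFiniteMeasure P] (hT : Measurable T) {B : Set X}
    (hB : MeasurableSet B) (n : ℕ) :
    Integrable (birkhoffSum T (B.indicator (1 : X → ℝ)) n) P := by
  refine Integrable.of_bound (measurable_birkhoffSum hT (measurable_one.indicator hB)
    n).aestronglyMeasurable n (ae_of_all _ fun x => ?_)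
  rw [Real.norm_of_nonneg (birkhoffSum_indicator_nonneg B n x)]
  exact birkhoffSum_indicator_le B n x

lemma integral_birkhoffSum_indicator [IsFiniteMeasure P] (hT : MeasurePreserving T P P)
    {B : Set X} (hB : MeasurableSet B) (n : ℕ) :
    ∫ x, birkhoffSum T (B.indicator (1 : X → ℝ)) n x ∂P = n * P.real B := by
  have hone (i : ℕ) : (fun x => B.indicator (1 : X → ℝ) (T^[i] x)) =
      (T^[i] ⁻¹' B).indicator 1 := by
    funext x; exact (Set.indicator_comp_right (s := B) (g := (1 : X → ℝ)) (T^[i])).symm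
  have hmeas (i : ℕ) : MeasurableSet (T^[i] ⁻¹' B) := (hT.measurable.iterate i) hB
  simp only [birkhoffSum]
  rw [integral_finsetSum]
  · simp only [hone, integral_indicator_one (hmeas _),
      (hT.iterate _).measureReal_preimage hB.nullMeasurableSet]
    simp
  · intro i _
    rw [hone]
    exact (integrable_const (1 : ℝ)).indicator (hmeas i)

lemma measurableSet_exists_lt_birkhoffSum (hT : Measurable T) {B : Set X} (hB : MeasurableSet B)
    (δ : ℝ) (N : ℕ) :
    MeasurableSet {y | ∃ m, 1 ≤ m ∧ m ≤ N ∧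
        δ * m < birkhoffSum T (B.indicator (1 : X → ℝ)) m y} := by
  simp only [Set.ofPred_exists]
  refine MeasurableSet.iUnion fun m => MeasurableSet.inter (.const _) (.inter (.const _) ?_)
  exact measurableSet_lt measurable_const (measurable_birkhoffSum hT (measurable_one.indicator hB) m)

lemma mul_measureReal_exists_lt_birkhoffSum_le_of_bounded [IsFiniteMeasure P]
    (hT : MeasurePreserving T P P) {B : Set X} (hB : MeasurableSet B) {δ : ℝ} (hδ : 0 ≤ δ)
    (N : ℕ) :
    δ * P.real {y | ∃ m, 1 ≤ m ∧ m ≤ N ∧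
        δ * m < birkhoffSum T (B.indicator (1 : X → ℝ)) m y} ≤ P.real B := by
  set E : Set X := {y | ∃ m, 1 ≤ m ∧ m ≤ N ∧
        δ * m < birkhoffSum T (B.indicator (1 : X → ℝ)) m y}
  have hEm : MeasurableSet E := measurableSet_exists_lt_birkhoffSum hT.measurable hB δ N
  have key (K : ℕ) : δ * (K * P.real E) ≤ (K + N) * P.real B := by
    have := integral_mono (μ := P)
      ((integrable_birkhoffSum_indicator hT.measurable hEm K).const_mul δ)
      (integrable_birkhoffSum_indicator hT.measurable hB (K + N))
      (fun x => mul_birkhoffSum_indicator_le B hδ N K x)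
    rw [integral_const_mul, integral_birkhoffSum_indicator hT hEm,
      integral_birkhoffSum_indicator hT hB] at this
    exact_mod_cast this
  by_contra! hlt
  obtain ⟨K, hK⟩ := exists_nat_gt (N * P.real B / (δ * P.real E - P.real B))
  rw [div_lt_iff₀ (by linarith)] at hK
  nlinarith [key K]

/-- The maximal inequality for the frequency of visits to `B`. -/
lemma mul_measureReal_exists_lt_birkhoffSum_le [IsFiniteMeasure P]
    (hT : MeasurePreserving T P P) {B : Set X} (hB : MeasurableSet B) {δ : ℝ} (hδ : 0 ≤ δ) :
    δ * P.real {y | ∃ m, 1 ≤ m ∧ δ * m < birkhoffSum T (B.indicator (1 : X → ℝ)) m y} ≤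
      P.real B := by
  have hU : {y | ∃ m, 1 ≤ m ∧ δ * m < birkhoffSum T (B.indicator (1 : X → ℝ)) m y} =
      ⋃ N, {y | ∃ m, 1 ≤ m ∧ m ≤ N ∧ δ * m < birkhoffSum T (B.indicator (1 : X → ℝ)) m y} := by
    ext y
    simp only [Set.mem_ofPred_eq, Set.mem_iUnion]
    exact ⟨fun ⟨m, h1, h2⟩ => ⟨m, m, h1, le_rfl, h2⟩, fun ⟨_, m, h1, _, h2⟩ => ⟨m, h1, h2⟩⟩
  have hmono : Monotone fun N : ℕ => {y | ∃ m, 1 ≤ m ∧ m ≤ N ∧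
      δ * m < birkhoffSum T (B.indicator (1 : X → ℝ)) m y} :=
    fun N N' hN y ⟨m, h1, h2, h3⟩ => ⟨m, h1, h2.trans hN, h3⟩
  rw [hU]
  refine le_of_tendsto (((ENNReal.tendsto_toReal (measure_ne_top P _)).comp
    (tendsto_measure_iUnion_atTop hmono)).const_mul δ) (Eventually.of_forall fun N => ?_)
  exact mul_measureReal_exists_lt_birkhoffSum_le_of_bounded hT hB hδ N

/-- Along sets of vanishing measure, almost every orbit visits some of them with frequency at most
`δ`, uniformly in time. This is all of the pointwise ergodic theorem that is needed below. -/
lemma ae_exists_birkhoffSum_indicator_le [IsFiniteMeasure P] (hT : MeasurePreserving T P P)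
    {B : ℕ → Set X} (hB : ∀ L, MeasurableSet (B L)) (hlim : Tendsto (fun L => P (B L)) atTop (𝓝 0))
    {δ : ℝ} (hδ : 0 < δ) :
    ∀ᵐ x ∂P, ∃ L, ∀ m, 1 ≤ m → birkhoffSum T ((B L).indicator (1 : X → ℝ)) m x ≤ δ * m := by
  have hle (L : ℕ) : P.real {x | ¬ ∃ L, ∀ m, 1 ≤ m →
      birkhoffSum T ((B L).indicator (1 : X → ℝ)) m x ≤ δ * m} ≤ P.real (B L) / δ := by
    rw [le_div_iff₀' hδ]
    refine le_trans (mul_le_mul_of_nonneg_left (measureReal_mono fun x hx => ?_) hδ.le)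
      (mul_measureReal_exists_lt_birkhoffSum_le hT (hB L) hδ.le)
    simp only [Set.mem_ofPred_eq, not_exists, not_forall, not_le] at hx ⊢
    obtain ⟨m, h1, h2⟩ := hx L
    exact ⟨m, h1, h2⟩
  have h0 : Tendsto (fun L => P.real (B L) / δ) atTop (𝓝 0) := by
    have := ((ENNReal.tendsto_toReal ENNReal.zero_ne_top).comp hlim).div_const δ
    simpa [measureReal_def] using this
  have := ge_of_tendsto' h0 hle
  rw [ae_iff, ← measureReal_eq_zero_iff]
  exact le_antisymm this measureReal_nonneg

end Measure

/-! ### Gapped submultiplicative sequences of functions -/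

/-- A sequence of `[0, 1]`-valued functions such that passing from `n` at `T x` to `n + 1` at `x`
(for words: adding a letter on the left) does not increase the value,
and that is submultiplicative along `T` up to factors `exp (c n)` and gaps of length `τ n`. -/
structure GappedSubmultiplicative (T : X → X) (q : ℕ → X → ℝ) (c : ℕ → ℝ) (τ : ℕ → ℕ) : Prop where
  nonneg : ∀ n x, 0 ≤ q n x
  le_one : ∀ n x, q n x ≤ 1
  succ_le : ∀ n x, q (n + 1) x ≤ q n (T x)
  gap_le : ∀ n m x, 1 ≤ n → 1 ≤ m →
    q (n + τ n + m) x ≤ Real.exp (c n) * q n x * q m (T^[n + τ n] x)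

variable {q : ℕ → X → ℝ} {c : ℕ → ℝ} {τ : ℕ → ℕ}

/-- The greedy covering bound. If from every time at which the orbit is outside `B` there starts a
block of length at most `C`, gap included, on which `q` decays at rate `ρ ≤ 0`, then `[0, m)` is
covered by such blocks, by visits to `B`, and by a final piece of length at most `C`. -/
lemma GappedSubmultiplicative.le_exp_of_cover (h : GappedSubmultiplicative T q c τ) {ρ : ℝ}
    (hρ : ρ ≤ 0) {C : ℕ} {B : Set X} (m : ℕ) (x : X)
    (hx : ∀ i, T^[i] x ∉ B → ∃ n, 1 ≤ n ∧ n + τ n ≤ C ∧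
      Real.exp (c n) * q n (T^[i] x) ≤ Real.exp (ρ * (n + τ n))) :
    q m x ≤ Real.exp (ρ * (m - birkhoffSum T (B.indicator (1 : X → ℝ)) m x - C)) := by
  induction m using Nat.strong_induction_on generalizing x with
  | _ m ih =>
  rcases le_or_gt m C with hm | hm
  · refine (h.le_one m x).trans (Real.one_le_exp (mul_nonneg_of_nonpos_of_nonpos hρ ?_))
    have h1 := birkhoffSum_indicator_nonneg (T := T) B m x
    have h2 : (m : ℝ) ≤ C := by exact_mod_cast hm
    linarith
  have hshift (j : ℕ) : ∀ i, T^[i] (T^[j] x) ∉ B → ∃ n, 1 ≤ n ∧ n + τ n ≤ C ∧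
      Real.exp (c n) * q n (T^[i] (T^[j] x)) ≤ Real.exp (ρ * (n + τ n)) := fun i => by
    rw [← Function.iterate_add_apply]; exact hx (i + j)
  by_cases hxB : x ∈ B
  · obtain ⟨k, rfl⟩ : ∃ k, m = k + 1 := ⟨m - 1, by omega⟩
    refine (h.succ_le k x).trans ((ih k (by omega) (T x) (hshift 1)).trans_eq ?_)
    rw [birkhoffSum_succ', Set.indicator_of_mem hxB]
    push_cast [Pi.one_apply]
    ring_nf
  · obtain ⟨n, hn, hnC, hqn⟩ := hx 0 hxB
    obtain ⟨k, rfl⟩ := Nat.exists_eq_add_of_le (hnC.trans hm.le)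
    calc q (n + τ n + k) x ≤ Real.exp (c n) * q n x * q k (T^[n + τ n] x) :=
          h.gap_le n k x hn (by omega)
      _ ≤ Real.exp (ρ * (n + τ n)) * Real.exp (ρ * (k - birkhoffSum T (B.indicator (1 : X → ℝ)) k
            (T^[n + τ n] x) - C)) := by
          gcongr
          · exact h.nonneg _ _
          · exact hqn
          · exact ih k (by omega) _ (hshift _)
      _ ≤ _ := by
          rw [← Real.exp_add, Real.exp_le_exp, birkhoffSum_add]
          have := mul_nonpos_of_nonpos_of_nonneg hρ
            (birkhoffSum_indicator_nonneg (T := T) B (n + τ n) x)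
          push_cast
          linarith

/-- The points at which `log (q n x) / n` has lower limit at most `r`, expressed without logarithms
so that the value `q n x = 0` needs no separate treatment. -/
def lowerRateSet (q : ℕ → X → ℝ) (r : ℝ) : Set X :=
  {x | ∀ k : ℕ, ∃ᶠ n : ℕ in atTop, q n x ≤ Real.exp ((r + 1 / ((k : ℝ) + 1)) * n)}

lemma GappedSubmultiplicative.preimage_lowerRateSet_subset (h : GappedSubmultiplicative T q c τ)
    (r : ℝ) : T ⁻¹' lowerRateSet q r ⊆ lowerRateSet q r := by
  intro x hx k
  have hlt : 1 / (((k + 1 : ℕ) : ℝ) + 1) < 1 / ((k : ℝ) + 1) :=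
    one_div_lt_one_div_of_lt (by positivity) (by push_cast; linarith)
  -- For large `n` the slack in the rate absorbs the missing letter.
  have hev : ∀ᶠ n : ℕ in atTop, -(r + 1 / ((k : ℝ) + 1)) ≤
      (1 / ((k : ℝ) + 1) - 1 / (((k + 1 : ℕ) : ℝ) + 1)) * n :=
    (tendsto_natCast_atTop_atTop.const_mul_atTop (sub_pos.2 hlt)).eventually_ge_atTop _
  refine (tendsto_add_atTop_nat 1).frequently (((hx (k + 1)).and_eventually hev).mono ?_)
  rintro n ⟨h1, h2⟩
  refine (h.succ_le n x).trans (h1.trans (Real.exp_le_exp.2 ?_))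
  push_cast at h2 ⊢
  linarith

variable [MeasurableSpace X] {P : Measure X}

lemma measurableSet_lowerRateSet (hq : ∀ n, Measurable (q n)) (r : ℝ) :
    MeasurableSet (lowerRateSet q r) := by
  simp only [lowerRateSet, frequently_atTop, Set.ofPred_forall, Set.ofPred_exists]
  refine .iInter fun k => .iInter fun a => .iUnion fun b => ?_
  exact MeasurableSet.inter (.const _) (measurableSet_le (hq b) measurable_const)

lemma GappedSubmultiplicative.ae_orbit_mem_lowerRateSet [IsFiniteMeasure P]
    (h : GappedSubmultiplicative T q c τ) (hT : MeasurePreserving T P P)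
    (hq : ∀ n, Measurable (q n)) (r : ℝ) :
    ∀ᵐ x ∂P, x ∈ lowerRateSet q r → ∀ i, T^[i] x ∈ lowerRateSet q r := by
  have hm := measurableSet_lowerRateSet hq r
  have hsub (i : ℕ) : T^[i] ⁻¹' lowerRateSet q r ⊆ lowerRateSet q r := by
    induction i with
    | zero => exact subset_rfl
    | succ i ih => exact fun x hx => h.preimage_lowerRateSet_subset r (ih hx)
  have hae (i : ℕ) : (T^[i] ⁻¹' lowerRateSet q r : Set X) =ᵐ[P] lowerRateSet q r :=
    ae_eq_of_subset_of_measure_ge (hsub i)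
      ((hT.iterate i).measure_preimage hm.nullMeasurableSet).ge
      ((hT.measurable.iterate i) hm).nullMeasurableSet (measure_ne_top _ _)
  have hall : ∀ᵐ x ∂P, ∀ i, x ∈ T^[i] ⁻¹' lowerRateSet q r ↔ x ∈ lowerRateSet q r :=
    ae_all_iff.2 fun i => (hae i).mem_iff
  filter_upwards [hall] with x hx hxr i using (hx i).2 hxr

/-- Almost everywhere, the upper exponential rate of `q` does not exceed the lower one: this is the
subadditive ergodic theorem for `log q`, in the presence of gaps and sublinear errors. -/
lemma GappedSubmultiplicative.ae_eventually_le_exp [IsFiniteMeasure P]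
    (h : GappedSubmultiplicative T q c τ) (hT : MeasurePreserving T P P)
    (hq : ∀ n, Measurable (q n)) (hc : c =o[atTop] fun n : ℕ => (n : ℝ))
    (hτ : (fun n : ℕ => (τ n : ℝ)) =o[atTop] fun n : ℕ => (n : ℝ)) {r s : ℝ} (hrs : r < s) :
    ∀ᵐ x ∂P, x ∈ lowerRateSet q r → ∀ᶠ n : ℕ in atTop, q n x ≤ Real.exp (s * n) := by
  rcases le_or_gt 0 s with hs | hs
  · exact ae_of_all _ fun x _ => Eventually.of_forall fun n =>
      (h.le_one n x).trans (Real.one_le_exp (by positivity))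
  obtain ⟨k, hk⟩ := exists_nat_one_div_lt (sub_pos.2 hrs)
  set r₁ : ℝ := r + 1 / ((k : ℝ) + 1) with hr₁
  have hr₁s : r₁ < s := by linarith
  set r₂ : ℝ := (r₁ + s) / 2 with hr₂
  have h12 : r₁ < r₂ := by linarith
  have h2s : r₂ < s := by linarith
  have hr₂0 : r₂ < 0 := h2s.trans hs
  -- `δ` solves `r₂ * (1 - 2 * δ) = s * (1 + δ)`: the gaps, the visits to the bad set and the final
  -- piece each cost a proportion `δ` of the time.
  obtain ⟨δ, hδ, hδeq⟩ : ∃ δ : ℝ, 0 < δ ∧ r₂ * (1 - 2 * δ) = s * (1 + δ) := by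
    refine ⟨(s - r₂) / (-(s + 2 * r₂)), div_pos (by linarith) (by linarith), ?_⟩
    have := div_mul_cancel₀ (s - r₂) (show -(s + 2 * r₂) ≠ 0 by linarith)
    generalize (s - r₂) / (-(s + 2 * r₂)) = δ at this ⊢
    linarith
  have hρ : r₂ / (1 + δ) ≤ 0 := div_nonpos_of_nonpos_of_nonneg hr₂0.le (by linarith)
  obtain ⟨N₀, hN₀⟩ := eventually_atTop.1
    (((hc.def (sub_pos.2 h12)).and (hτ.def hδ)).and (eventually_ge_atTop 1))
  -- The points of the lower rate set from which no decay is seen up to length `L`.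
  set B : ℕ → Set X := fun L => lowerRateSet q r ∩
    {x | ∀ n, N₀ ≤ n → n ≤ L → Real.exp (r₁ * n) < q n x} with hB
  have hBm (L : ℕ) : MeasurableSet (B L) := by
    refine (measurableSet_lowerRateSet hq r).inter ?_
    simp only [Set.ofPred_forall]
    exact .iInter fun n => .iInter fun _ => .iInter fun _ => measurableSet_lt measurable_const (hq n)
  have hBanti : Antitone B := fun L L' hL x hx => ⟨hx.1, fun n h1 h2 => hx.2 n h1 (h2.trans hL)⟩
  have hBempty : ⋂ L, B L = ∅ := by
    refine Set.eq_empty_of_forall_notMem fun x hx => ?_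
    rw [Set.mem_iInter] at hx
    obtain ⟨n, hn, hqn⟩ := ((hx 0).1 k).forall_exists_of_atTop N₀
    exact absurd hqn (not_le.2 ((hx n).2 n hn le_rfl))
  have hBlim : Tendsto (fun L => P (B L)) atTop (𝓝 0) := by
    have := tendsto_measure_iInter_atTop (μ := P) (fun L => (hBm L).nullMeasurableSet) hBanti
      ⟨0, measure_ne_top _ _⟩
    rwa [hBempty, measure_empty] at this
  filter_upwards [ae_exists_birkhoffSum_indicator_le hT hBm hBlim hδ,
    h.ae_orbit_mem_lowerRateSet hT hq r] with x ⟨L, hL⟩ horb hxr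
  have hgood : ∀ i, T^[i] x ∉ B L → ∃ n, 1 ≤ n ∧
      n + τ n ≤ ∑ j ∈ Finset.range (L + 1), (j + τ j) ∧
      Real.exp (c n) * q n (T^[i] x) ≤ Real.exp (r₂ / (1 + δ) * (n + τ n)) := by
    intro i hi
    simp only [hB, Set.mem_inter_iff, horb hxr i, true_and, Set.mem_ofPred_eq, not_forall,
      not_lt] at hi
    obtain ⟨n, hn, hnL, hqn⟩ := hi
    obtain ⟨⟨hcn, hτn⟩, hn1⟩ := hN₀ n hn
    refine ⟨n, hn1, Finset.single_le_sum (f := fun j => j + τ j) (fun _ _ => Nat.zero_le _)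
      (Finset.mem_range.2 (by omega)), ?_⟩
    rw [Real.norm_natCast] at hcn
    rw [Real.norm_natCast, Real.norm_natCast] at hτn
    calc Real.exp (c n) * q n (T^[i] x) ≤ Real.exp ((r₂ - r₁) * n) * Real.exp (r₁ * n) := by
          gcongr
          · exact h.nonneg _ _
          · exact (le_abs_self _).trans hcn
      _ = Real.exp (r₂ / (1 + δ) * ((1 + δ) * n)) := by
          rw [← Real.exp_add]; congr 1; field_simp; ring
      _ ≤ _ := Real.exp_le_exp.2 (mul_le_mul_of_nonpos_left (by linarith) hρ)
  have hlast : ∀ᶠ m : ℕ in atTop,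
      ((∑ j ∈ Finset.range (L + 1), (j + τ j) : ℕ) : ℝ) ≤ δ * m :=
    (tendsto_natCast_atTop_atTop.const_mul_atTop hδ).eventually_ge_atTop _
  filter_upwards [hlast, eventually_ge_atTop 1] with m hm hm1
  refine (h.le_exp_of_cover hρ m x hgood).trans (Real.exp_le_exp.2 ?_)
  calc _ ≤ r₂ / (1 + δ) * ((1 - 2 * δ) * m) :=
        mul_le_mul_of_nonpos_left (by linarith [hL m hm1]) hρ
    _ = r₂ * (1 - 2 * δ) / (1 + δ) * m := by ring
    _ = s * m := by rw [hδeq]; field_simp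

lemma ENNReal.log_ofReal_div_lt_iff {y r : ℝ} {n : ℕ} (hn : 1 ≤ n) :
    ENNReal.log (ENNReal.ofReal y) / (n : EReal) < (r : EReal) ↔ y < Real.exp (r * n) := by
  have hn0 : (0 : ℝ) < n := by exact_mod_cast hn
  have hexp : ((r * n : ℝ) : EReal) = ENNReal.log (ENNReal.ofReal (Real.exp (r * n))) := by
    rw [ENNReal.log_ofReal_of_pos (Real.exp_pos _), Real.log_exp]
  rw [show ((n : ℕ) : EReal) = ((n : ℝ) : EReal) from rfl,
    EReal.div_lt_iff (by exact_mod_cast hn0) (EReal.coe_ne_top _), ← EReal.coe_mul, hexp,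
    ENNReal.log_lt_log_iff, ENNReal.ofReal_lt_ofReal_iff (Real.exp_pos _)]

lemma EReal.dense_range_ratCast : Dense (Set.range fun r : ℚ => ((r : ℝ) : EReal)) :=
  dense_of_exists_between fun a b hab => by
    obtain ⟨r, h1, h2⟩ := EReal.lt_iff_exists_rat_btwn.1 hab
    exact ⟨_, ⟨r, rfl⟩, h1, h2⟩

/-- A subadditive ergodic theorem with gaps and sublinear errors, for `log q` with values in
`[-∞, 0]`. -/
theorem GappedSubmultiplicative.ae_exists_tendsto_log_div [IsFiniteMeasure P]
    (h : GappedSubmultiplicative T q c τ) (hT : MeasurePreserving T P P)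
    (hq : ∀ n, Measurable (q n)) (hc : c =o[atTop] fun n : ℕ => (n : ℝ))
    (hτ : (fun n : ℕ => (τ n : ℝ)) =o[atTop] fun n : ℕ => (n : ℝ)) :
    ∀ᵐ x ∂P, ∃ l : EReal,
      Tendsto (fun n : ℕ => ENNReal.log (ENNReal.ofReal (q n x)) / (n : EReal)) atTop (𝓝 l) := by
  have hall : ∀ᵐ x ∂P, ∀ r s : ℚ, r < s → x ∈ lowerRateSet q r →
      ∀ᶠ n : ℕ in atTop, q n x ≤ Real.exp (s * n) := by
    simp only [ae_all_iff]
    exact fun r s hrs => h.ae_eventually_le_exp hT hq hc hτ (by exact_mod_cast hrs)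
  filter_upwards [hall] with x hx
  refine tendsto_of_no_upcrossings EReal.dense_range_ratCast ?_
  rintro _ ⟨r, rfl⟩ _ ⟨s, rfl⟩ hrs ⟨h1, h2⟩
  have hrs' : r < s := by simpa using hrs
  have hmem : x ∈ lowerRateSet q r := fun k => by
    refine (h1.and_eventually (eventually_ge_atTop 1)).mono fun n ⟨hn, hn1⟩ => ?_
    refine ((ENNReal.log_ofReal_div_lt_iff hn1).1 hn).le.trans (Real.exp_le_exp.2 ?_)
    gcongr
    have : 0 ≤ 1 / ((k : ℝ) + 1) := by positivity
    linarith
  obtain ⟨t, hrt, hts⟩ := exists_between hrs'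
  refine h2 ?_
  filter_upwards [hx r t hrt hmem, eventually_ge_atTop 1] with n hn hn1
  refine not_lt.2 ((ENNReal.log_ofReal_div_lt_iff hn1).2 (hn.trans_lt (Real.exp_lt_exp.2 ?_))).le
  have : (0 : ℝ) < n := by exact_mod_cast hn1
  gcongr

end Ergodic

/-! ### The deterministic case -/

/-- Fekete's lemma with gaps and sublinear errors. It is the subadditive ergodic theorem for the
functions `exp (a n)` on a one-point space. -/
lemma exists_tendsto_div_of_gapped_subadditive {a c : ℕ → ℝ} {τ : ℕ → ℕ} (ha : Antitone a)
    (ha0 : ∀ n, a n ≤ 0)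
    (hsub : ∀ n m, 1 ≤ n → 1 ≤ m → a (n + τ n + m) ≤ c n + a n + a m)
    (hc : c =o[atTop] fun n : ℕ => (n : ℝ))
    (hτ : (fun n : ℕ => (τ n : ℝ)) =o[atTop] fun n : ℕ => (n : ℝ)) :
    ∃ l : EReal, Tendsto (fun n : ℕ => ((a n / n : ℝ) : EReal)) atTop (𝓝 l) := by
  have h : GappedSubmultiplicative (id : Unit → Unit) (fun n _ => Real.exp (a n)) c τ :=
    { nonneg := fun _ _ => (Real.exp_pos _).le
      le_one := fun n _ => Real.exp_le_one_iff.2 (ha0 n)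
      succ_le := fun n _ => Real.exp_le_exp.2 (ha n.le_succ)
      gap_le := fun n m _ hn hm => by
        rw [← Real.exp_add, ← Real.exp_add]
        exact Real.exp_le_exp.2 (hsub n m hn hm) }
  have := h.ae_exists_tendsto_log_div (P := Measure.dirac ()) (MeasurePreserving.id _)
    (fun _ => measurable_const) hc hτ
  rw [ae_dirac_eq, eventually_pure] at this
  obtain ⟨l, hl⟩ := this
  refine ⟨l, hl.congr fun n => ?_⟩
  rw [ENNReal.log_ofReal_of_pos (Real.exp_pos _), Real.log_exp, EReal.coe_div]
  rfl

/-! ### Relative entropy on finite spaces -/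

lemma MeasureTheory.Measure.absolutelyContinuous_of_singleton {α : Type*} [Countable α]
    [MeasurableSpace α] {μ ν : Measure α} (h : ∀ a, ν {a} = 0 → μ {a} = 0) :
    μ ≪ ν := by
  refine Measure.AbsolutelyContinuous.mk fun s _ hs => ?_
  rw [← Set.biUnion_of_singleton s, measure_biUnion_null_iff s.to_countable] at hs ⊢
  exact fun a ha => h a (hs a ha)

section FiniteSpace

variable {α : Type*} [Finite α] [MeasurableSpace α] [MeasurableSingletonClass α]
  {μ ν : Measure α}

lemma integral_llr_eq_integral_log_sub_log [IsFiniteMeasure μ] [IsFiniteMeasure ν] (h : μ ≪ ν) :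
    ∫ a, llr μ ν a ∂μ = ∫ a, (Real.log (μ.real {a}) - Real.log (ν.real {a})) ∂μ := by
  refine integral_congr_ae (ae_iff_of_countable.2 fun a ha => ?_)
  have hν : ν {a} ≠ 0 := fun h0 => ha (h h0)
  have hprod : (μ.rnDeriv ν a).toReal * ν.real {a} = μ.real {a} := by
    have := Measure.setLIntegral_rnDeriv h {a}
    rw [lintegral_singleton] at this
    rw [measureReal_def, measureReal_def, ← ENNReal.toReal_mul, this]
  have hμ0 : μ.real {a} ≠ 0 := by simpa [measureReal_eq_zero_iff] using ha
  have hν0 : ν.real {a} ≠ 0 := by simpa [measureReal_eq_zero_iff] using hν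
  have hr0 : (μ.rnDeriv ν a).toReal ≠ 0 := fun h0 => hμ0 (by rw [← hprod, h0, zero_mul])
  simp only [llr, ← hprod, Real.log_mul hr0 hν0]
  ring

lemma klDiv_eq_ofReal_integral_log_sub_log [IsProbabilityMeasure μ] [IsProbabilityMeasure ν]
    (h : μ ≪ ν) :
    InformationTheory.klDiv μ ν =
      ENNReal.ofReal (∫ a, (Real.log (μ.real {a}) - Real.log (ν.real {a})) ∂μ) := by
  rw [InformationTheory.klDiv_of_ac_of_integrable h .of_finite,
    integral_llr_eq_integral_log_sub_log h]
  simp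

/-- Gibbs' inequality on a finite space. -/
lemma integral_log_sub_log_nonneg [IsProbabilityMeasure μ] [IsProbabilityMeasure ν] (h : μ ≪ ν) :
    0 ≤ ∫ a, (Real.log (μ.real {a}) - Real.log (ν.real {a})) ∂μ := by
  have := InformationTheory.integral_llr_add_sub_measure_univ_nonneg h .of_finite
  rw [integral_llr_eq_integral_log_sub_log h] at this
  simpa using this

end FiniteSpace

namespace OneSidedShift

/-! ### Word probabilities and their mean logarithms -/

section Words

variable {A : Type*}

lemma iterate_shift_apply (i k : ℕ) (x : ℕ → A) : shift^[i] x k = x (k + i) := by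
  induction i generalizing x with
  | zero => rfl
  | succ i ih => rw [Function.iterate_succ_apply, ih]; simp [shift, add_assoc]

lemma window_iterate_shift (i k m : ℕ) (x : ℕ → A) :
    window k m (shift^[i] x) = window (i + k) m x := by
  funext j
  simp only [window, iterate_shift_apply]
  congr 1
  omega

lemma window_eq_iff {k m : ℕ} {x y : ℕ → A} :
    window k m y = window k m x ↔ ∀ j < m, y (k + j) = x (k + j) :=
  ⟨fun h j hj => congr_fun h ⟨j, hj⟩, fun h => funext fun j => h j j.2⟩

lemma window_eq_of_window_eq {n k m : ℕ} (h : k + m ≤ n) {x y : ℕ → A}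
    (hxy : window 0 n y = window 0 n x) : window k m y = window k m x := by
  rw [window_eq_iff] at hxy ⊢
  intro j hj
  simpa using hxy (k + j) (by omega)

lemma window_add_eq_iff {n m : ℕ} {x y : ℕ → A} :
    window 0 (n + m) y = window 0 (n + m) x ↔
      window 0 n y = window 0 n x ∧ window n m y = window n m x := by
  refine ⟨fun h => ⟨window_eq_of_window_eq (by omega) h, window_eq_of_window_eq (by omega) h⟩,
    fun ⟨h1, h2⟩ => ?_⟩
  rw [window_eq_iff] at *
  intro j hj
  rcases lt_or_ge j n with hjn | hjn
  · exact h1 j hjn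
  · obtain ⟨i, rfl⟩ := Nat.exists_eq_add_of_le hjn
    simpa using h2 i (by omega)

variable [MeasurableSpace A]

lemma measurable_window (k m : ℕ) : Measurable (window k m : (ℕ → A) → Fin m → A) :=
  measurable_pi_lambda _ fun _ => measurable_pi_apply _

/-- The probability that a `Q`-random sequence starts with the first `n` letters of `x`. -/
noncomputable def wordProb (Q : Measure (ℕ → A)) (n : ℕ) (x : ℕ → A) : ℝ :=
  Q.real {y | window 0 n y = window 0 n x}

variable {P Q : Measure (ℕ → A)}

lemma wordProb_nonneg (n : ℕ) (x : ℕ → A) : 0 ≤ wordProb Q n x := measureReal_nonneg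

lemma wordProb_le_one [IsProbabilityMeasure Q] (n : ℕ) (x : ℕ → A) : wordProb Q n x ≤ 1 :=
  measureReal_le_one

lemma ofReal_wordProb [IsFiniteMeasure Q] (n : ℕ) (x : ℕ → A) :
    ENNReal.ofReal (wordProb Q n x) = Q {y | window 0 n y = window 0 n x} :=
  ofReal_measureReal

lemma wordProb_antitone [IsFiniteMeasure Q] (x : ℕ → A) : Antitone fun n => wordProb Q n x :=
  fun n m hnm => measureReal_mono fun y (hy : window 0 m y = window 0 m x) =>
    window_eq_of_window_eq (by omega) hy

instance [IsProbabilityMeasure P] (n : ℕ) : IsProbabilityMeasure (marginal P n) :=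
  Measure.isProbabilityMeasure_map (measurable_window 0 n).aemeasurable

lemma measurableSet_window_eq [Countable A] [MeasurableSingletonClass A] (k m : ℕ)
    (a : Fin m → A) :
    MeasurableSet {y : ℕ → A | window k m y = a} :=
  measurable_window k m (measurableSet_singleton a)

lemma marginal_real_singleton [Countable A] [MeasurableSingletonClass A] (n : ℕ)
    (x : ℕ → A) :
    (marginal Q n).real {window 0 n x} = wordProb Q n x :=
  map_measureReal_apply (measurable_window 0 n) (measurableSet_singleton _)

lemma integral_comp_iterate_shift (hP : ShiftInvariant P) (k : ℕ) {g : (ℕ → A) → ℝ}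
    (hg : Measurable g) : ∫ x, g (shift^[k] x) ∂P = ∫ x, g x ∂P := by
  have hk := MeasurePreserving.iterate hP k
  conv_rhs => rw [← hk.map_eq]
  rw [integral_map hk.measurable.aemeasurable hg.aestronglyMeasurable]

/-- The `P`-mean of the log-probability under `Q` of the initial word of length `n`: minus the cross
entropy of the marginals. It is meaningful when `marginal P n ≪ marginal Q n`; otherwise
`Real.log 0 = 0` hides infinite terms. -/
noncomputable def meanLogProb (P Q : Measure (ℕ → A)) (n : ℕ) : ℝ :=
  ∫ x, Real.log (wordProb Q n x) ∂P

lemma meanLogProb_nonpos [IsProbabilityMeasure Q] (n : ℕ) : meanLogProb P Q n ≤ 0 :=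
  integral_nonpos fun x => Real.log_nonpos (wordProb_nonneg n x) (wordProb_le_one n x)

variable [Finite A] [MeasurableSingletonClass A]

lemma measurable_wordProb (n : ℕ) : Measurable (wordProb Q n) :=
  (measurable_of_countable fun a : Fin n → A => Q.real {y | window 0 n y = a}).comp
    (measurable_window 0 n)

lemma wordProb_iterate_shift (hQ : ShiftInvariant Q) (k m : ℕ) (x : ℕ → A) :
    wordProb Q m (shift^[k] x) = Q.real {y | window k m y = window k m x} := by
  rw [wordProb, ← (hQ.iterate k).measureReal_preimage
    (measurableSet_window_eq 0 m _).nullMeasurableSet]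
  congr 1
  ext y
  simp only [Set.mem_preimage, Set.mem_ofPred_eq, window_iterate_shift, add_zero]

lemma wordProb_add_le_wordProb_iterate_shift [IsFiniteMeasure Q] (hQ : ShiftInvariant Q)
    (k m : ℕ) (x : ℕ → A) : wordProb Q (k + m) x ≤ wordProb Q m (shift^[k] x) := by
  rw [wordProb_iterate_shift hQ]
  exact measureReal_mono fun y hy => window_eq_of_window_eq le_rfl hy

lemma gappedSubmultiplicative_wordProb [IsProbabilityMeasure Q] (hQ : ShiftInvariant Q)
    {c : ℕ → ℝ} {τ : ℕ → ℕ}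
    (hdec : ∀ n m : ℕ, 1 ≤ n → 1 ≤ m → ∀ (a : Fin n → A) (b : Fin m → A),
      Q {x | window 0 n x = a ∧ window (n + τ n) m x = b} ≤
        ENNReal.ofReal (Real.exp (c n)) * Q {x | window 0 n x = a} *
          Q {x | window (n + τ n) m x = b}) :
    GappedSubmultiplicative shift (wordProb Q) c τ where
  nonneg := wordProb_nonneg
  le_one := wordProb_le_one
  succ_le n x := by
    rw [add_comm]
    exact wordProb_add_le_wordProb_iterate_shift hQ 1 n x
  gap_le n m x hn hm := by
    rw [wordProb_iterate_shift hQ]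
    have h := ENNReal.toReal_mono (by finiteness) (hdec n m hn hm (window 0 n x)
      (window (n + τ n) m x))
    rw [ENNReal.toReal_mul, ENNReal.toReal_mul, ENNReal.toReal_ofReal (Real.exp_pos _).le] at h
    refine le_trans (measureReal_mono fun y hy => ?_) h
    exact ⟨window_eq_of_window_eq (by omega) hy, window_eq_of_window_eq le_rfl hy⟩

/-! ### Entropy and relative entropy of the marginals -/

lemma integrable_comp_window [IsFiniteMeasure P] {k m : ℕ} (g : (Fin m → A) → ℝ) :
    Integrable (fun x => g (window k m x)) P :=
  Integrable.comp_measurable (μ := P) (g := g) .of_finite (measurable_window k m)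

lemma integrable_log_wordProb [IsFiniteMeasure P] (n : ℕ) :
    Integrable (fun x => Real.log (wordProb Q n x)) P :=
  integrable_comp_window fun a : Fin n → A => Real.log (Q.real {y | window 0 n y = a})

lemma integrable_log_wordProb_iterate_shift [IsFiniteMeasure P] (hP : ShiftInvariant P)
    (k n : ℕ) : Integrable (fun x => Real.log (wordProb Q n (shift^[k] x))) P :=
  (MeasurePreserving.iterate hP k).integrable_comp_of_integrable (integrable_log_wordProb n)

lemma ae_wordProb_pos [IsFiniteMeasure Q] {n : ℕ}
    (h : marginal P n ≪ marginal Q n) : ∀ᵐ x ∂P, 0 < wordProb Q n x := by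
  have h1 : ∀ᵐ a ∂(marginal P n), 0 < Q.real {y | window 0 n y = a} := by
    refine ae_iff_of_countable.2 fun a ha => ?_
    rw [measureReal_def]
    refine ENNReal.toReal_pos (fun h0 => ha (h ?_)) (measure_ne_top _ _)
    rw [marginal, Measure.map_apply (measurable_window 0 n) (measurableSet_singleton _)]
    exact h0
  exact ae_of_ae_map (measurable_window 0 n).aemeasurable h1

lemma marginal_absolutelyContinuous_of_le {m n : ℕ} (hmn : m ≤ n)
    (h : marginal P n ≪ marginal Q n) : marginal P m ≪ marginal Q m := by
  have hmap (R : Measure (ℕ → A)) :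
      marginal R m = (marginal R n).map fun a j => a (Fin.castLE hmn j) := by
    rw [marginal, marginal, Measure.map_map (measurable_of_countable _) (measurable_window 0 n)]
    rfl
  rw [hmap P, hmap Q]
  exact h.map (measurable_of_countable _)

lemma klDiv_marginal [IsProbabilityMeasure P] [IsProbabilityMeasure Q] {n : ℕ}
    (h : marginal P n ≪ marginal Q n) :
    InformationTheory.klDiv (marginal P n) (marginal Q n) =
      ENNReal.ofReal (meanLogProb P P n - meanLogProb P Q n) := by
  have hmap (g : (Fin n → A) → ℝ) : ∫ a, g a ∂(marginal P n) = ∫ x, g (window 0 n x) ∂P :=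
    integral_map (measurable_window 0 n).aemeasurable
      (measurable_of_countable g).aestronglyMeasurable
  rw [klDiv_eq_ofReal_integral_log_sub_log h, hmap]
  simp only [marginal_real_singleton]
  rw [integral_sub (integrable_log_wordProb n) (integrable_log_wordProb n)]
  rfl

/-- The block entropies `-meanLogProb P P n` of an invariant measure are subadditive, by Gibbs'
inequality for the law of two consecutive blocks and the product of their laws. -/
lemma subadditive_neg_meanLogProb [IsProbabilityMeasure P] (hP : ShiftInvariant P) :
    Subadditive fun n => -meanLogProb P P n := by
  intro n m
  have hw : Measurable fun x : ℕ → A => (window 0 n x, window n m x) :=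
    (measurable_window 0 n).prodMk (measurable_window n m)
  set μ : Measure ((Fin n → A) × (Fin m → A)) := P.map fun x => (window 0 n x, window n m x) with hμ
  have : IsProbabilityMeasure (P.map (window n m)) :=
    Measure.isProbabilityMeasure_map (measurable_window n m).aemeasurable
  have : IsProbabilityMeasure μ := Measure.isProbabilityMeasure_map hw.aemeasurable
  set ν := (marginal P n).prod (P.map (window n m)) with hν
  have hμs (x : ℕ → A) : μ.real {(window 0 n x, window n m x)} = wordProb P (n + m) x := by
    rw [hμ, map_measureReal_apply hw (measurableSet_singleton _), wordProb]
    congr 1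
    ext y
    simp [window_add_eq_iff]
  have hνs (x : ℕ → A) : ν.real {(window 0 n x, window n m x)} =
      wordProb P n x * wordProb P m (shift^[n] x) := by
    rw [hν, ← Set.singleton_prod_singleton, measureReal_prod_prod, marginal_real_singleton,
      map_measureReal_apply (measurable_window n m) (measurableSet_singleton _),
      wordProb_iterate_shift hP]
    rfl
  have hac : μ ≪ ν := by
    refine Measure.absolutelyContinuous_of_singleton fun ⟨a, b⟩ h0 => ?_
    rw [hν, ← Set.singleton_prod_singleton, Measure.prod_prod, mul_eq_zero, marginal,
      Measure.map_apply (measurable_window 0 n) (measurableSet_singleton _),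
      Measure.map_apply (measurable_window n m) (measurableSet_singleton _)] at h0
    rw [hμ, Measure.map_apply hw (measurableSet_singleton _)]
    rcases h0 with h0 | h0
    · exact measure_mono_null (fun y hy => congr_arg Prod.fst hy) h0
    · exact measure_mono_null (fun y hy => congr_arg Prod.snd hy) h0
  have hpos : ∀ᵐ x ∂P, 0 < wordProb P (n + m) x := ae_wordProb_pos .rfl
  have h := integral_log_sub_log_nonneg hac
  rw [hμ, integral_map hw.aemeasurable (measurable_of_countable _).aestronglyMeasurable, ← hμ] at h
  simp only [hμs, hνs] at h
  have hlog : ∫ x, (Real.log (wordProb P (n + m) x) -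
      Real.log (wordProb P n x * wordProb P m (shift^[n] x))) ∂P =
      ∫ x, (Real.log (wordProb P (n + m) x) -
        (Real.log (wordProb P n x) + Real.log (wordProb P m (shift^[n] x)))) ∂P := by
    refine integral_congr_ae ?_
    filter_upwards [hpos] with x hx
    rw [Real.log_mul (hx.trans_le (wordProb_antitone x (by omega))).ne'
      (hx.trans_le (wordProb_add_le_wordProb_iterate_shift hP n m x)).ne']
  have h1 := integrable_log_wordProb (P := P) (Q := P) n
  have h2 := integrable_log_wordProb_iterate_shift (Q := P) hP n m
  have h12 : Integrable (fun x => Real.log (wordProb P n x) +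
      Real.log (wordProb P m (shift^[n] x))) P := h1.add h2
  rw [hlog, integral_sub (integrable_log_wordProb _) h12, integral_add h1 h2,
    integral_comp_iterate_shift hP n
      (g := fun x => Real.log (wordProb P m x)) (measurable_wordProb m).log] at h
  simp only [meanLogProb]
  linarith

lemma exists_tendsto_meanLogProb_self_div [IsProbabilityMeasure P] (hP : ShiftInvariant P) :
    ∃ l : ℝ, Tendsto (fun n : ℕ => meanLogProb P P n / n) atTop (𝓝 l) := by
  have hbdd : BddBelow (Set.range fun n : ℕ => -meanLogProb P P n / n) := by
    refine ⟨0, ?_⟩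
    rintro _ ⟨n, rfl⟩
    exact div_nonneg (neg_nonneg.2 (meanLogProb_nonpos n)) n.cast_nonneg
  refine ⟨_, ((subadditive_neg_meanLogProb hP).tendsto_lim hbdd).neg.congr fun n => ?_⟩
  ring

lemma exists_tendsto_meanLogProb_div [IsProbabilityMeasure P] [IsProbabilityMeasure Q]
    (hP : ShiftInvariant P) (hQ : ShiftInvariant Q) (hdec : UpperDecoupled Q)
    (hac : ∀ n, marginal P n ≪ marginal Q n) :
    ∃ l : EReal, Tendsto (fun n : ℕ => ((meanLogProb P Q n / n : ℝ) : EReal)) atTop (𝓝 l) := by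
  obtain ⟨c, τ, hc, hτ, hdec⟩ := hdec
  have hgap := gappedSubmultiplicative_wordProb hQ hdec
  refine exists_tendsto_div_of_gapped_subadditive (fun n m hnm => ?_) meanLogProb_nonpos
    (fun n m hn hm => ?_) hc hτ
  · refine integral_mono_ae (integrable_log_wordProb m) (integrable_log_wordProb n) ?_
    filter_upwards [ae_wordProb_pos (hac m)] with x hx
    exact Real.log_le_log hx (wordProb_antitone x hnm)
  · have h1 := integrable_log_wordProb (P := P) (Q := Q) n
    have h2 := integrable_log_wordProb_iterate_shift (Q := Q) hP (n + τ n) m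
    have h01 : Integrable (fun x => c n + Real.log (wordProb Q n x)) P :=
      (integrable_const (c n)).add h1
    calc meanLogProb P Q (n + τ n + m) ≤
        ∫ x, (c n + Real.log (wordProb Q n x) +
          Real.log (wordProb Q m (shift^[n + τ n] x))) ∂P := by
          refine integral_mono_ae (integrable_log_wordProb _) (h01.add h2) ?_
          filter_upwards [ae_wordProb_pos (hac (n + τ n + m))] with x hx
          have hx1 := (hx.trans_le (wordProb_antitone x (by omega : n ≤ n + τ n + m))).ne'
          have hx2 := (hx.trans_le
            (wordProb_add_le_wordProb_iterate_shift hQ (n + τ n) m x)).ne'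
          have := Real.log_le_log hx (hgap.gap_le n m x hn hm)
          rwa [Real.log_mul (mul_ne_zero (Real.exp_ne_zero _) hx1) hx2,
            Real.log_mul (Real.exp_ne_zero _) hx1, Real.log_exp] at this
      _ = c n + meanLogProb P Q n + meanLogProb P Q m := by
          rw [integral_add h01 h2, integral_add (integrable_const _) h1, integral_comp_iterate_shift hP _
            (g := fun x => Real.log (wordProb Q m x)) (measurable_wordProb m).log]
          simp [meanLogProb]

/-! ### The two limits -/

lemma exists_measurable_tendsto_log_div [IsProbabilityMeasure P] [IsProbabilityMeasure Q]
    (hP : ShiftInvariant P) (hQ : ShiftInvariant Q) (hdec : UpperDecoupled Q) :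
    ∃ h : (ℕ → A) → EReal, Measurable h ∧
      ∀ᵐ x ∂P, Tendsto
        (fun n : ℕ => ENNReal.log (Q {y | window 0 n y = window 0 n x}) / (n : EReal))
        atTop (𝓝 (h x)) := by
  obtain ⟨c, τ, hc, hτ, hdec⟩ := hdec
  refine ⟨fun x => limsup
    (fun n : ℕ => ENNReal.log (Q {y | window 0 n y = window 0 n x}) / (n : EReal)) atTop,
    Measurable.limsup fun n => ?_, ?_⟩
  · exact (measurable_of_countable fun a : Fin n → A =>
      ENNReal.log (Q {y | window 0 n y = a}) / (n : EReal)).comp (measurable_window 0 n)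
  · filter_upwards [(gappedSubmultiplicative_wordProb hQ hdec).ae_exists_tendsto_log_div hP
      measurable_wordProb hc hτ] with x ⟨l, hl⟩
    simp only [ofReal_wordProb] at hl
    rwa [hl.limsup_eq]

lemma exists_hasSpecificRelativeEntropy [IsProbabilityMeasure P] [IsProbabilityMeasure Q]
    (hP : ShiftInvariant P) (hQ : ShiftInvariant Q) (hdec : UpperDecoupled Q) :
    ∃ s : ℝ≥0∞, HasSpecificRelativeEntropy P Q s := by
  by_cases hac : ∀ n, marginal P n ≪ marginal Q n
  · obtain ⟨e, he⟩ := exists_tendsto_meanLogProb_self_div hP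
    obtain ⟨l, hl⟩ := exists_tendsto_meanLogProb_div hP hQ hdec hac
    have hsum : Tendsto (fun n : ℕ => ((meanLogProb P P n / n : ℝ) : EReal) +
        -((meanLogProb P Q n / n : ℝ) : EReal)) atTop (𝓝 (e + -l)) :=
      (EReal.continuousAt_add (p := ((e : EReal), -l)) (.inl (EReal.coe_ne_top e))
        (.inl (EReal.coe_ne_bot e))).tendsto.comp
        ((EReal.tendsto_coe.2 he).prodMk_nhds hl.neg)
    refine ⟨EReal.toENNReal (e + -l),
      ((EReal.continuous_toENNReal.tendsto _).comp hsum).congr' ?_⟩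
    filter_upwards [eventually_ge_atTop 1] with n hn
    have hn0 : (0 : ℝ) < n := by exact_mod_cast hn
    rw [klDiv_marginal (hac n), Function.comp_apply, ← EReal.coe_neg, ← EReal.coe_add,
      EReal.real_coe_toENNReal, ← ENNReal.ofReal_natCast n, ← ENNReal.ofReal_div_of_pos hn0]
    congr 1
    ring
  · push Not at hac
    obtain ⟨n₀, hn₀⟩ := hac
    refine ⟨⊤, tendsto_const_nhds.congr' ?_⟩
    filter_upwards [eventually_ge_atTop n₀] with n hn
    rw [InformationTheory.klDiv_of_not_ac
      fun h => hn₀ (marginal_absolutelyContinuous_of_le hn h),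
      ENNReal.top_div_of_ne_top (ENNReal.natCast_ne_top n)]

end Words

end OneSidedShift

theorem mainTheorem4 {A : Type*} [Finite A] [MeasurableSpace A] [MeasurableSingletonClass A]
    (P Q : Measure (ℕ → A)) [IsProbabilityMeasure P] [IsProbabilityMeasure Q]
    (hP : OneSidedShift.ShiftInvariant P) (hQ : OneSidedShift.ShiftInvariant Q)
    (hdec : OneSidedShift.UpperDecoupled Q) :
    (∃ h : (ℕ → A) → EReal, Measurable h ∧
      ∀ᵐ x ∂P, Tendsto
        (fun n : ℕ =>
          ENNReal.log (Q {y | OneSidedShift.window 0 n y = OneSidedShift.window 0 n x}) /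
            (n : EReal))
        atTop (𝓝 (h x))) ∧
    ∃ s : ℝ≥0∞, OneSidedShift.HasSpecificRelativeEntropy P Q s := by
  exact ⟨OneSidedShift.exists_measurable_tendsto_log_div hP hQ hdec,
    OneSidedShift.exists_hasSpecificRelativeEntropy hP hQ hdec⟩
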